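/- Let $\mathbb{F}=\mathbb{F}_q$ be a finite field of odd characteristic with $q$ elements, and let $\chi$ be the non-trivial quadratic character of $\mathbb{F}^\times$, extended to $\mathbb{F}$ by $\chi(0)=0$. For an integer $r\ge 0$ put $$\mathcal{M}_3(r;q)=\sum_{d}\Big(-\sum_{\theta\in\mathbb{F}}\chi(d(\theta))\Big)^{r},\qquad \mathcal{M}_4(r;q)=\sum_{d}\Big(-1-\sum_{\theta\in\mathbb{F}}\chi(d(\theta))\Big)^{r},$$ where $d$ runs over the monic square-free polynomials in $\mathbb{F}[x]$ of degree $3$, respectively of degree $4$. Then $$\mathcal{M}_4(r;q)=\begin{cases} q\,\mathcal{M}_3(r;q) & \text{if } r \text{ is even},\\ -\mathcal{M}_3(r+1;q) & \text{if } r \text{ is odd}.\end{cases}$$ -/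

import Mathlib

/-- The set of monic square-free polynomials of degree `k` over `F`. -/
def monicSquarefree (F : Type*) [Field F] (k : ℕ) : Set (Polynomial F) :=
  {d | d.Monic ∧ d.natDegree = k ∧ Squarefree d}

/-- Over a finite field there are only finitely many monic square-free polynomials of degree `k`. -/
theorem monicSquarefree_finite (F : Type*) [Field F] [Finite F] (k : ℕ) :
    (monicSquarefree F k).Finite := by
  have hfin : (Polynomial.degreeLT F (k + 1) : Set (Polynomial F)).Finite :=
    by
    have : Finite (Polynomial.degreeLT F (k + 1)) := Finite.of_equiv _ (Polynomial.degreeLTEquiv F (k + 1)).symm.toEquiv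
    exact Set.toFinite _
  refine hfin.subset ?_
  rintro d ⟨-, hd, -⟩
  rw [SetLike.mem_coe, Polynomial.mem_degreeLT]
  exact lt_of_le_of_lt Polynomial.degree_le_natDegree (by rw [hd]; exact_mod_cast Nat.lt_succ_self k)

/-- The moment-sum `M_k(r; q)`: the sum over the monic square-free `d ∈ F[x]` of degree `k` of
`(- ε - ∑_{θ ∈ F} χ(d(θ))) ^ r`, where `χ` is the quadratic character of `F` with `χ(0) = 0`, and
`ε` is `1` for even `k` and `0` for odd `k`. -/
noncomputable def momentSum (F : Type*) [Field F] [Fintype F] [DecidableEq F] (k r : ℕ) : ℤ :=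
  ∑ d ∈ (monicSquarefree_finite F k).toFinset,
    (-(if Even k then 1 else 0) - ∑ θ : F, quadraticChar F (d.eval θ)) ^ r

/-!
Let `f` be a monic square-free cubic and `P` an affine point of the curve `y² = f(x)`. A line
through `-P` meets the curve in two further points, whose abscissas are the roots of a quadratic.
The discriminant of this quadratic is, up to a shift of the variable, a monic square-free quartic
`d` in the slope of the line. Every monic square-free quartic arises from exactly one pair `(f, P)`,
and `y² = d(x)` has the same trace of Frobenius `a` as `y² = f(x)`. Since the latter has `q - a`
affine points, for every function `g`
`∑_{deg d = 4} g(a_d) = ∑_{deg f = 3} (q - a_f) g(a_f)`,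
so that `M₄(r) = q M₃(r) - M₃(r + 1)`. Quadratic twisting changes the sign of `a_f`, which makes the
odd moments `M₃` vanish.
-/


open Polynomial Finset

section Invariance

theorem squarefree_mulEquiv_iff {M N : Type*} [Monoid M] [Monoid N] (e : M ≃* N) {x : M} :
    Squarefree (e x) ↔ Squarefree x := by
  constructor
  · intro h y hy
    rw [← MulEquiv.isUnit_map e]
    exact h (e y) (by simpa only [map_mul] using map_dvd e hy)
  · intro h y hy
    rw [← MulEquiv.isUnit_map e.symm]
    exact h (e.symm y) (by simpa only [map_mul, e.symm_apply_apply] using map_dvd e.symm hy)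

variable {F : Type*} [Field F]

theorem taylor_mem_monicSquarefree_iff (m : F) {k : ℕ} {f : F[X]} :
    taylor m f ∈ monicSquarefree F k ↔ f ∈ monicSquarefree F k := by
  have hsq : Squarefree (taylor m f) ↔ Squarefree f :=
    squarefree_mulEquiv_iff (taylorEquiv m).toMulEquiv
  simp only [monicSquarefree, Set.mem_ofPred_eq, Monic, leadingCoeff_taylor, natDegree_taylor, hsq]

/-- Multiplication of all roots by a unit `n`, as an automorphism of the multiplicative monoid of
polynomials. For non-square `n` it realises the quadratic twist of `y² = f(x)`. -/
noncomputable def scaleRootsEquiv (n : Fˣ) : F[X] ≃* F[X] where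
  toFun f := f.scaleRoots n
  invFun f := f.scaleRoots ↑n⁻¹
  left_inv f := by dsimp only; rw [← scaleRoots_mul, n.mul_inv, scaleRoots_one]
  right_inv f := by dsimp only; rw [← scaleRoots_mul, n.inv_mul, scaleRoots_one]
  map_mul' f g := mul_scaleRoots_of_noZeroDivisors f g n

theorem scaleRootsEquiv_apply (n : Fˣ) (f : F[X]) : scaleRootsEquiv n f = f.scaleRoots n := rfl

theorem scaleRootsEquiv_mem_monicSquarefree_iff (n : Fˣ) {k : ℕ} {f : F[X]} :
    scaleRootsEquiv n f ∈ monicSquarefree F k ↔ f ∈ monicSquarefree F k := by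
  simp only [monicSquarefree, Set.mem_ofPred_eq, squarefree_mulEquiv_iff]
  simp only [scaleRootsEquiv_apply, monic_scaleRoots_iff, natDegree_scaleRoots]

end Invariance

section ResidualQuartic

variable {F : Type*} [Field F]

/-- The discriminant, in `s`, of `s² + (A - x²) s + (B + 2 β x)`, as a polynomial in `x`. The roots
of this quadratic are the abscissas of the two points, besides `(0, -β)`, which the line of slope
`x` through `(0, -β)` has in common with the curve `y² = s³ + A s² + B s + β²`. -/
noncomputable def residualQuartic (A B β : F) : F[X] :=
  (X ^ 2 - C A) ^ 2 - C (8 * β) * X - C (4 * B)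

theorem residualQuartic_eq (A B β : F) : residualQuartic A B β =
    X ^ 4 + C (-2 * A) * X ^ 2 + C (-8 * β) * X + C (A ^ 2 - 4 * B) := by
  simp only [residualQuartic, map_sub, map_mul, map_pow, map_neg, map_ofNat]
  ring

theorem residualQuartic_monic (A B β : F) : (residualQuartic A B β).Monic := by
  rw [residualQuartic_eq]
  monicity!

theorem natDegree_residualQuartic (A B β : F) : (residualQuartic A B β).natDegree = 4 := by
  rw [residualQuartic_eq]
  compute_degree!

theorem map_residualQuartic {K : Type*} [Field K] (φ : F →+* K) (A B β : F) :
    (residualQuartic A B β).map φ = residualQuartic (φ A) (φ B) (φ β) := by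
  simp only [residualQuartic, Polynomial.map_sub, Polynomial.map_mul, Polynomial.map_pow, map_X,
    map_C, map_mul, map_ofNat, Polynomial.map_ofNat]

theorem eval_residualQuartic (A B β x : F) :
    (residualQuartic A B β).eval x = (x ^ 2 - A) ^ 2 - 8 * β * x - 4 * B := by
  simp only [residualQuartic, eval_sub, eval_mul, eval_pow, eval_X, eval_C]

theorem eval_derivative_residualQuartic (A B β x : F) :
    (derivative (residualQuartic A B β)).eval x = 4 * (x * (x ^ 2 - A) - 2 * β) := by
  rw [residualQuartic_eq]
  simp only [derivative_add, derivative_X_pow, derivative_C_mul, derivative_X, derivative_C,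
    eval_add, eval_mul, eval_pow, eval_X, eval_C, eval_one, eval_zero, Nat.cast_ofNat,
    Nat.add_one_sub_one]
  ring

theorem coeff_residualQuartic (A B β : F) :
    (residualQuartic A B β).coeff 3 = 0 ∧ (residualQuartic A B β).coeff 2 = -2 * A ∧
      (residualQuartic A B β).coeff 1 = -8 * β ∧
        (residualQuartic A B β).coeff 0 = A ^ 2 - 4 * B := by
  rw [residualQuartic_eq]
  simp [coeff_X, coeff_C, coeff_X_pow, -map_mul, -map_pow, -map_sub, -map_neg]

theorem four_ne_zero_of_two_ne_zero (h2 : (2 : F) ≠ 0) : (4 : F) ≠ 0 := by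
  convert pow_ne_zero 2 h2
  norm_num

theorem eight_ne_zero_of_two_ne_zero (h2 : (2 : F) ≠ 0) : (8 : F) ≠ 0 := by
  convert pow_ne_zero 3 h2
  norm_num

theorem residualQuartic_injective (h2 : (2 : F) ≠ 0) {A B β A' B' β' : F}
    (h : residualQuartic A B β = residualQuartic A' B' β') : A = A' ∧ B = B' ∧ β = β' := by
  obtain ⟨-, hA, hβ, hB⟩ := coeff_residualQuartic A B β
  obtain ⟨-, hA', hβ', hB'⟩ := coeff_residualQuartic A' B' β'
  rw [h] at hA hβ hB
  obtain rfl : A = A' := mul_left_cancel₀ h2 (by linear_combination hA - hA')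
  have h4 := four_ne_zero_of_two_ne_zero h2
  have h8 := eight_ne_zero_of_two_ne_zero h2
  exact ⟨rfl, mul_left_cancel₀ h4 (by linear_combination hB - hB'),
    mul_left_cancel₀ h8 (by linear_combination hβ - hβ')⟩

theorem exists_eq_residualQuartic (h2 : (2 : F) ≠ 0) {d : F[X]} (hm : d.Monic)
    (hd : d.natDegree = 4) (h3 : d.coeff 3 = 0) : ∃ A B β, d = residualQuartic A B β := by
  have h4 := four_ne_zero_of_two_ne_zero h2
  have h8 := eight_ne_zero_of_two_ne_zero h2
  obtain ⟨A, hA⟩ : ∃ A, d.coeff 2 = -2 * A := ⟨-d.coeff 2 / 2, by field_simp⟩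
  obtain ⟨β, hβ⟩ : ∃ β, d.coeff 1 = -8 * β := ⟨-d.coeff 1 / 8, by field_simp⟩
  obtain ⟨B, hB⟩ : ∃ B, d.coeff 0 = A ^ 2 - 4 * B := ⟨(A ^ 2 - d.coeff 0) / 4, by field_simp; ring⟩
  refine ⟨A, B, β, ?_⟩
  have hsum := hm.as_sum
  simp only [hd, sum_range_succ, sum_range_zero, h3, hA, hβ, hB] at hsum
  rw [residualQuartic_eq, hsum]
  simp only [map_zero]
  ring

theorem eval_monicCubic (A B E s : F) :
    (Cubic.toPoly ⟨1, A, B, E⟩).eval s = s ^ 3 + A * s ^ 2 + B * s + E := by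
  simp [Cubic.toPoly]

theorem eval_derivative_monicCubic (A B E s : F) :
    (derivative (Cubic.toPoly ⟨1, A, B, E⟩)).eval s = 3 * s ^ 2 + 2 * A * s + B := by
  simp only [Cubic.toPoly, derivative_add, derivative_C_mul, derivative_X_pow, derivative_X,
    derivative_C, eval_add, eval_mul, eval_pow, eval_X, eval_C, eval_one, eval_zero, Nat.cast_ofNat,
    Nat.add_one_sub_one]
  ring

theorem not_separable_iff_exists_double_root {K : Type*} [Field K] [IsAlgClosed K] {p : K[X]} :
    ¬ p.Separable ↔ ∃ x, p.eval x = 0 ∧ (derivative p).eval x = 0 := by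
  rw [separable_def, isCoprime_iff_aeval_ne_zero_of_isAlgClosed (k := K) K]
  push Not
  simp only [coe_aeval_eq_eval]

/-- Both sides say that `s² + (A - x²) s + (B + 2 β x) = 0` is a singular curve in the
`(x, s)`-plane: its discriminants in `s` and in `x` are the quartic and four times the cubic. -/
theorem exists_double_root_residualQuartic_iff {K : Type*} [Field K] [IsAlgClosed K]
    (h2 : (2 : K) ≠ 0) (A B β : K) :
    (∃ x, (residualQuartic A B β).eval x = 0 ∧ (derivative (residualQuartic A B β)).eval x = 0) ↔
      ∃ s, (Cubic.toPoly ⟨1, A, B, β ^ 2⟩).eval s = 0 ∧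
        (derivative (Cubic.toPoly ⟨1, A, B, β ^ 2⟩)).eval s = 0 := by
  simp only [eval_residualQuartic, eval_derivative_residualQuartic, eval_monicCubic,
    eval_derivative_monicCubic]
  have h4 := four_ne_zero_of_two_ne_zero h2
  constructor
  · rintro ⟨x, hd, hd'⟩
    obtain ⟨s, hs⟩ : ∃ s, x ^ 2 - A = 2 * s := ⟨(x ^ 2 - A) / 2, by field_simp⟩
    obtain rfl : β = x * s :=
      mul_left_cancel₀ h4 (mul_left_cancel₀ h2 (by linear_combination 4 * x * hs - hd'))
    have hB : B = s ^ 2 - 2 * x ^ 2 * s :=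
      mul_left_cancel₀ h4 (by linear_combination (x ^ 2 - A + 2 * s) * hs - hd)
    exact ⟨s, by linear_combination s * hB - s ^ 2 * hs, by linear_combination hB - 2 * s * hs⟩
  · rintro ⟨s, hf, hf'⟩
    by_cases hs : s = 0
    · obtain rfl : B = 0 := by simpa [hs] using hf'
      obtain rfl : β = 0 := by simpa [hs] using hf
      obtain ⟨x, hx⟩ := IsAlgClosed.exists_pow_nat_eq A two_pos
      exact ⟨x, by simp [hx], by simp [hx]⟩
    · obtain ⟨x, rfl⟩ : ∃ x, β = s * x := ⟨β / s, by field_simp⟩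
      have hA : A = x ^ 2 - 2 * s :=
        mul_left_cancel₀ (pow_ne_zero 2 hs) (by linear_combination s * hf' - hf)
      subst hA
      have hB : B = s ^ 2 - 2 * x ^ 2 * s := by linear_combination hf'
      exact ⟨x, by linear_combination -4 * hB, by ring⟩

theorem separable_residualQuartic_iff (h2 : (2 : F) ≠ 0) (A B β : F) :
    (residualQuartic A B β).Separable ↔ (Cubic.toPoly ⟨1, A, B, β ^ 2⟩).Separable := by
  let φ := algebraMap F (AlgebraicClosure F)
  have h2' : (2 : AlgebraicClosure F) ≠ 0 := by
    simpa only [map_ofNat] using (map_ne_zero φ).2 h2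
  rw [← separable_map φ, ← separable_map φ, map_residualQuartic, ← Cubic.map_toPoly, Cubic.map,
    ← not_iff_not, not_separable_iff_exists_double_root, not_separable_iff_exists_double_root]
  simp only [map_one, map_pow]
  exact exists_double_root_residualQuartic_iff h2' (φ A) (φ B) (φ β)

theorem ne_zero_or_ne_zero_of_squarefree_cubic {A B β : F}
    (h : Squarefree (Cubic.toPoly ⟨1, A, B, β ^ 2⟩)) : β ≠ 0 ∨ B ≠ 0 := by
  by_contra! h0
  obtain ⟨rfl, rfl⟩ := h0
  refine not_isUnit_X (h X ⟨X + C A, ?_⟩)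
  simp only [Cubic.toPoly, ne_eq, OfNat.ofNat_ne_zero, not_false_eq_true, zero_pow, map_zero,
    map_one]
  ring

end ResidualQuartic

section PointedCubic

theorem coeff_taylor_of_natDegree_eq_succ {R : Type*} [CommSemiring R] {f : R[X]} {n : ℕ}
    (hn : f.natDegree = n + 1) (r : R) :
    (taylor r f).coeff n = f.coeff n + (n + 1) * f.leadingCoeff * r := by
  have hdeg : (hasseDeriv n f).natDegree < 2 := by
    have := natDegree_hasseDeriv_le f n
    omega
  rw [taylor_coeff, eval_eq_sum_range' hdeg, sum_range_succ, sum_range_one, leadingCoeff, hn]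
  simp [hasseDeriv_coeff, Nat.add_comm 1 n]

variable {F : Type*} [Field F]

theorem monic_cubic_eq_toPoly {f : F[X]} (hm : f.Monic) (hd : f.natDegree = 3) :
    f = Cubic.toPoly ⟨1, f.coeff 2, f.coeff 1, f.coeff 0⟩ := by
  have hlead : f.coeff 3 = 1 := hd ▸ hm.coeff_natDegree
  have hle : f.degree ≤ 3 := natDegree_le_iff_degree_le.1 hd.le
  rw [← hlead]
  exact (congr_arg Subtype.val (Cubic.equiv.apply_symm_apply ⟨f, hle⟩)).symm

/-- The monic quartic attached to a monic cubic `f` and an affine point `P` of `y² = f(x)`: the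
`residualQuartic` of the curve translated so that `P` has abscissa `0`. It is translated back, which
makes its cubic coefficient remember the abscissa of `P`. -/
noncomputable def pointedQuartic (f : F[X]) (P : F × F) : F[X] :=
  taylor P.1 (residualQuartic ((taylor P.1 f).coeff 2) ((taylor P.1 f).coeff 1) P.2)

theorem taylor_eq_toPoly_of_mem {f : F[X]} (hf : f ∈ monicSquarefree F 3) {P : F × F}
    (hP : P.2 ^ 2 = f.eval P.1) : taylor P.1 f =
      Cubic.toPoly ⟨1, (taylor P.1 f).coeff 2, (taylor P.1 f).coeff 1, P.2 ^ 2⟩ := by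
  obtain ⟨hm, hd, -⟩ := (taylor_mem_monicSquarefree_iff P.1).2 hf
  rw [hP, ← taylor_coeff_zero]
  exact monic_cubic_eq_toPoly hm hd

theorem residualQuartic_mem_monicSquarefree_iff [PerfectField F] (h2 : (2 : F) ≠ 0) (A B β : F) :
    residualQuartic A B β ∈ monicSquarefree F 4 ↔
      Cubic.toPoly ⟨1, A, B, β ^ 2⟩ ∈ monicSquarefree F 3 := by
  simp only [monicSquarefree, Set.mem_ofPred_eq, ← PerfectField.separable_iff_squarefree,
    separable_residualQuartic_iff h2, residualQuartic_monic, natDegree_residualQuartic,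
    Cubic.monic_of_a_eq_one', Cubic.natDegree_of_a_ne_zero' one_ne_zero]

theorem pointedQuartic_mem_monicSquarefree [PerfectField F] (h2 : (2 : F) ≠ 0) {f : F[X]}
    (hf : f ∈ monicSquarefree F 3) {P : F × F} (hP : P.2 ^ 2 = f.eval P.1) :
    pointedQuartic f P ∈ monicSquarefree F 4 := by
  rw [pointedQuartic, taylor_mem_monicSquarefree_iff, residualQuartic_mem_monicSquarefree_iff h2,
    ← taylor_eq_toPoly_of_mem hf hP, taylor_mem_monicSquarefree_iff]
  exact hf

theorem coeff_three_pointedQuartic (f : F[X]) (P : F × F) :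
    (pointedQuartic f P).coeff 3 = 4 * P.1 := by
  rw [pointedQuartic, coeff_taylor_of_natDegree_eq_succ (natDegree_residualQuartic _ _ _),
    (coeff_residualQuartic _ _ _).1, residualQuartic_monic]
  norm_num

theorem pointedQuartic_injective (h2 : (2 : F) ≠ 0) {f f' : F[X]} {P P' : F × F}
    (hf : f ∈ monicSquarefree F 3) (hP : P.2 ^ 2 = f.eval P.1)
    (hf' : f' ∈ monicSquarefree F 3) (hP' : P'.2 ^ 2 = f'.eval P'.1)
    (h : pointedQuartic f P = pointedQuartic f' P') : f = f' ∧ P = P' := by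
  obtain ⟨m, β⟩ := P
  obtain ⟨m', β'⟩ := P'
  obtain rfl : m = m' := mul_left_cancel₀ (four_ne_zero_of_two_ne_zero h2) <| by
    rw [← coeff_three_pointedQuartic f (m, β), h, coeff_three_pointedQuartic]
  obtain ⟨hA, hB, rfl⟩ := residualQuartic_injective h2 (taylor_injective m h)
  have hff' : taylor m f = taylor m f' := by
    rw [taylor_eq_toPoly_of_mem hf hP, taylor_eq_toPoly_of_mem hf' hP', hA, hB]
  exact ⟨taylor_injective m hff', rfl⟩

theorem exists_pointedQuartic_eq [PerfectField F] (h2 : (2 : F) ≠ 0) {d : F[X]}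
    (hd : d ∈ monicSquarefree F 4) :
    ∃ f ∈ monicSquarefree F 3, ∃ P : F × F, P.2 ^ 2 = f.eval P.1 ∧ pointedQuartic f P = d := by
  have h4 := four_ne_zero_of_two_ne_zero h2
  obtain ⟨m, hm⟩ : ∃ m, d.coeff 3 = 4 * m := ⟨d.coeff 3 / 4, by field_simp⟩
  have he := (taylor_mem_monicSquarefree_iff (-m)).2 hd
  have he3 : (taylor (-m) d).coeff 3 = 0 := by
    rw [coeff_taylor_of_natDegree_eq_succ hd.2.1, hd.1.leadingCoeff, hm]
    norm_num
  obtain ⟨A, B, β, hABβ⟩ := exists_eq_residualQuartic h2 he.1 he.2.1 he3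
  set f := taylor (-m) (Cubic.toPoly ⟨1, A, B, β ^ 2⟩) with hf
  have htaylor : taylor m f = Cubic.toPoly ⟨1, A, B, β ^ 2⟩ := by
    rw [hf, taylor_taylor, add_neg_cancel, taylor_zero]
  refine ⟨f, ?_, (m, β), ?_, ?_⟩
  · rwa [hf, taylor_mem_monicSquarefree_iff, ← residualQuartic_mem_monicSquarefree_iff h2, ← hABβ]
  · rw [← taylor_coeff_zero, htaylor, Cubic.coeff_eq_d]
  · rw [pointedQuartic, htaylor, Cubic.coeff_eq_b, Cubic.coeff_eq_c, ← hABβ, taylor_taylor,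
      add_neg_cancel, taylor_zero]

end PointedCubic

section FrobeniusTrace

variable {F : Type*} [Field F] [Fintype F] [DecidableEq F]

/-- The trace of Frobenius of the smooth projective model of `y² = d(x)`, for `d` monic and
squarefree: `q + 1` minus its number of points, of which two lie at infinity if the degree is even
and one if it is odd. -/
noncomputable def frobeniusTrace (d : F[X]) : ℤ :=
  -(if Even d.natDegree then 1 else 0) - ∑ θ : F, quadraticChar F (d.eval θ)

theorem momentSum_eq_sum_frobeniusTrace_pow (k r : ℕ) :
    momentSum F k r = ∑ d ∈ (monicSquarefree_finite F k).toFinset, frobeniusTrace d ^ r := by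
  refine sum_congr rfl fun d hd => ?_
  rw [frobeniusTrace, ((Set.Finite.mem_toFinset _).1 hd).2.1]

theorem frobeniusTrace_taylor (m : F) (d : F[X]) :
    frobeniusTrace (taylor m d) = frobeniusTrace d := by
  simp only [frobeniusTrace, natDegree_taylor, taylor_eval]
  congr 1
  exact Equiv.sum_comp (Equiv.addRight m) fun θ => quadraticChar F (d.eval θ)

theorem frobeniusTrace_scaleRootsEquiv {n : Fˣ} (hn : quadraticChar F n = -1) {d : F[X]}
    (hd : Odd d.natDegree) : frobeniusTrace (scaleRootsEquiv n d) = -frobeniusTrace d := by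
  have htwist (θ : F) : quadraticChar F ((d.scaleRoots n).eval (n * θ)) =
      -quadraticChar F (d.eval θ) := by
    rw [scaleRoots_eval_mul, map_mul, map_pow, hn, hd.neg_one_pow, neg_one_mul]
  rw [frobeniusTrace, frobeniusTrace, scaleRootsEquiv_apply, natDegree_scaleRoots,
    if_neg (Nat.not_even_iff_odd.2 hd), ← Equiv.sum_comp n.mulLeft]
  simp only [Units.mulLeft_apply, htwist, sum_neg_distrib]
  ring

theorem momentSum_eq_zero_of_odd (hF : ringChar F ≠ 2) {k r : ℕ} (hk : Odd k) (hr : Odd r) :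
    momentSum F k r = 0 := by
  obtain ⟨n, hn⟩ := quadraticChar_exists_neg_one' hF
  suffices h : momentSum F k r = -momentSum F k r by linarith
  rw [momentSum_eq_sum_frobeniusTrace_pow, ← sum_neg_distrib]
  refine sum_equiv (scaleRootsEquiv n).toEquiv ?_ ?_
  · intro d
    rw [Set.Finite.mem_toFinset, Set.Finite.mem_toFinset]
    exact (scaleRootsEquiv_mem_monicSquarefree_iff n).symm
  · intro d hd
    have hodd : Odd d.natDegree := by rwa [((Set.Finite.mem_toFinset _).1 hd).2.1]
    change _ = -frobeniusTrace (scaleRootsEquiv n d) ^ r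
    rw [frobeniusTrace_scaleRootsEquiv hn hodd, hr.neg_pow, neg_neg]

theorem card_filter_sq_eq (hF : ringChar F ≠ 2) (a : F) :
    (#{x : F | x ^ 2 = a} : ℤ) = quadraticChar F a + 1 := by
  rw [← quadraticChar_card_sqrts hF a]
  congr 2
  ext
  simp

theorem card_affine_points (hF : ringChar F ≠ 2) {f : F[X]} (hf : Odd f.natDegree) :
    (#{P : F × F | P.2 ^ 2 = f.eval P.1} : ℤ) = Fintype.card F - frobeniusTrace f := by
  have hfiber : #{P : F × F | P.2 ^ 2 = f.eval P.1} = ∑ x, #{y : F | y ^ 2 = f.eval x} := by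
    simp only [card_filter, Fintype.sum_prod_type]
  rw [hfiber, Nat.cast_sum, frobeniusTrace, if_neg (Nat.not_even_iff_odd.2 hf)]
  simp only [card_filter_sq_eq hF, sum_add_distrib, sum_const, card_univ, nsmul_one]
  ring

theorem card_filter_quadratic_eq_zero (hF : ringChar F ≠ 2) {a : F} (ha : a ≠ 0) (b c : F) :
    (#{x : F | a * (x * x) + b * x + c = 0} : ℤ) = quadraticChar F (discrim a b c) + 1 := by
  have h2 : (2 : F) ≠ 0 := Ring.two_ne_zero hF
  have : NeZero (2 : F) := ⟨h2⟩
  let complete : F ≃ F := (Equiv.mulLeft₀ (2 * a) (mul_ne_zero h2 ha)).trans (Equiv.addRight b)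
  rw [← card_filter_sq_eq hF, card_equiv complete]
  intro x
  simp only [mem_filter_univ, quadratic_eq_zero_iff_discrim_eq_sq ha]
  exact eq_comm

theorem card_filter_slope (hF : ringChar F ≠ 2) {A B β : F} (h : β ≠ 0 ∨ B ≠ 0) (s : F) :
    (#{x : F | s ^ 2 + (A - x ^ 2) * s + (B + 2 * β * x) = 0} : ℤ) =
      quadraticChar F (s ^ 3 + A * s ^ 2 + B * s + β ^ 2) + 1 - if s = 0 then 1 else 0 := by
  have h2 : (2 : F) ≠ 0 := Ring.two_ne_zero hF
  split_ifs with hs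
  · subst hs
    by_cases hβ : β = 0
    · simp [hβ, h.resolve_left (not_not.2 hβ)]
    · have hroot (x : F) : 0 ^ 2 + (A - x ^ 2) * 0 + (B + 2 * β * x) = 0 ↔ x = -B / (2 * β) := by
        rw [eq_div_iff (mul_ne_zero h2 hβ)]
        constructor <;> intro hx <;> linear_combination hx
      have hcubic : 0 ^ 3 + A * 0 ^ 2 + B * 0 + β ^ 2 = β ^ 2 := by ring
      rw [hcubic, quadraticChar_sq_one' hβ]
      simp only [hroot, filter_eq', mem_univ, if_true, card_singleton]
      norm_num
  · have hdisc : discrim (-s) (2 * β) (s ^ 2 + A * s + B) =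
        2 ^ 2 * (s ^ 3 + A * s ^ 2 + B * s + β ^ 2) := by
      rw [discrim]
      ring
    have hcard := card_filter_quadratic_eq_zero hF (neg_ne_zero.2 hs) (2 * β) (s ^ 2 + A * s + B)
    rw [hdisc, map_mul, quadraticChar_sq_one' h2, one_mul] at hcard
    rw [sub_zero, ← hcard]
    congr! 4
    ring

theorem card_filter_abscissa (hF : ringChar F ≠ 2) (A B β x : F) :
    (#{s : F | s ^ 2 + (A - x ^ 2) * s + (B + 2 * β * x) = 0} : ℤ) =
      quadraticChar F ((residualQuartic A B β).eval x) + 1 := by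
  have hdisc : (residualQuartic A B β).eval x = discrim 1 (A - x ^ 2) (B + 2 * β * x) := by
    rw [eval_residualQuartic, discrim]
    ring
  rw [hdisc, ← card_filter_quadratic_eq_zero hF one_ne_zero]
  simp only [one_mul, sq]

/-- The curve `s² + (A - x²) s + (B + 2 β x) = 0` is counted by projecting to `x` and to `s`. -/
theorem frobeniusTrace_residualQuartic (hF : ringChar F ≠ 2) {A B β : F} (h : β ≠ 0 ∨ B ≠ 0) :
    frobeniusTrace (residualQuartic A B β) =
      frobeniusTrace (Cubic.toPoly ⟨1, A, B, β ^ 2⟩) := by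
  have hcount : ∑ x : F, (#{s : F | s ^ 2 + (A - x ^ 2) * s + (B + 2 * β * x) = 0} : ℤ) =
      ∑ s : F, (#{x : F | s ^ 2 + (A - x ^ 2) * s + (B + 2 * β * x) = 0} : ℤ) := by
    exact_mod_cast sum_card_bipartiteAbove_eq_sum_card_bipartiteBelow (s := univ) (t := univ)
      fun x s : F => s ^ 2 + (A - x ^ 2) * s + (B + 2 * β * x) = 0
  simp only [card_filter_abscissa hF, card_filter_slope hF h, sum_add_distrib, sum_sub_distrib,
    sum_ite_eq', mem_univ, if_true, sum_const, card_univ, nsmul_one] at hcount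
  simp only [frobeniusTrace, natDegree_residualQuartic, Cubic.natDegree_of_a_ne_zero' one_ne_zero,
    eval_monicCubic, if_pos (show Even 4 by decide), if_neg (show ¬ Even 3 by decide)]
  linarith

theorem frobeniusTrace_pointedQuartic (hF : ringChar F ≠ 2) {f : F[X]}
    (hf : f ∈ monicSquarefree F 3) {P : F × F} (hP : P.2 ^ 2 = f.eval P.1) :
    frobeniusTrace (pointedQuartic f P) = frobeniusTrace f := by
  have hsq := ((taylor_mem_monicSquarefree_iff P.1).2 hf).2.2
  rw [taylor_eq_toPoly_of_mem hf hP] at hsq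
  rw [pointedQuartic, frobeniusTrace_taylor,
    frobeniusTrace_residualQuartic hF (ne_zero_or_ne_zero_of_squarefree_cubic hsq),
    ← taylor_eq_toPoly_of_mem hf hP, frobeniusTrace_taylor]

theorem sum_pointedQuartic (h2 : (2 : F) ≠ 0) {M : Type*} [AddCommMonoid M] (G : F[X] → M) :
    ∑ f ∈ (monicSquarefree_finite F 3).toFinset, ∑ P : F × F with P.2 ^ 2 = f.eval P.1,
      G (pointedQuartic f P) = ∑ d ∈ (monicSquarefree_finite F 4).toFinset, G d := by
  rw [sum_sigma']
  refine sum_bij (fun p _ => pointedQuartic p.1 p.2) ?_ ?_ ?_ fun _ _ => rfl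
  · rintro ⟨f, P⟩ h
    simp only [mem_sigma, mem_filter_univ, Set.Finite.mem_toFinset] at h ⊢
    exact pointedQuartic_mem_monicSquarefree h2 h.1 h.2
  · rintro ⟨f, P⟩ h ⟨f', P'⟩ h' heq
    simp only [mem_sigma, mem_filter_univ, Set.Finite.mem_toFinset] at h h'
    obtain ⟨rfl, rfl⟩ := pointedQuartic_injective h2 h.1 h.2 h'.1 h'.2 heq
    rfl
  · intro d hd
    obtain ⟨f, hf, P, hP, rfl⟩ :=
      exists_pointedQuartic_eq h2 ((Set.Finite.mem_toFinset _).1 hd)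
    exact ⟨⟨f, P⟩, by simp [hf, hP], rfl⟩

theorem sum_comp_frobeniusTrace_four (hF : ringChar F ≠ 2) {M : Type*} [AddCommGroup M]
    (g : ℤ → M) :
    ∑ d ∈ (monicSquarefree_finite F 4).toFinset, g (frobeniusTrace d) =
      ∑ f ∈ (monicSquarefree_finite F 3).toFinset,
        (Fintype.card F - frobeniusTrace f) • g (frobeniusTrace f) := by
  rw [← sum_pointedQuartic (Ring.two_ne_zero hF)]
  refine sum_congr rfl fun f hf => ?_
  rw [Set.Finite.mem_toFinset] at hf
  have hodd : Odd f.natDegree := hf.2.1 ▸ by decide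
  calc ∑ P : F × F with P.2 ^ 2 = f.eval P.1, g (frobeniusTrace (pointedQuartic f P))
      = ∑ P : F × F with P.2 ^ 2 = f.eval P.1, g (frobeniusTrace f) :=
        sum_congr rfl fun P hP => by
          rw [frobeniusTrace_pointedQuartic hF hf ((mem_filter_univ P).1 hP)]
    _ = (Fintype.card F - frobeniusTrace f) • g (frobeniusTrace f) := by
        rw [sum_const, ← natCast_zsmul, card_affine_points hF hodd]

theorem momentSum_four (hF : ringChar F ≠ 2) (r : ℕ) :
    momentSum F 4 r = Fintype.card F * momentSum F 3 r - momentSum F 3 (r + 1) := by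
  simp only [momentSum_eq_sum_frobeniusTrace_pow, mul_sum, ← sum_sub_distrib]
  rw [sum_comp_frobeniusTrace_four hF (· ^ r)]
  refine sum_congr rfl fun f _ => ?_
  rw [smul_eq_mul]
  ring

end FrobeniusTrace

theorem mainTheorem12 {F : Type*} [Field F] [Fintype F] [DecidableEq F] (hF : ringChar F ≠ 2)
    (r : ℕ) :
    (Even r → momentSum F 4 r = (Fintype.card F : ℤ) * momentSum F 3 r) ∧
      (Odd r → momentSum F 4 r = -momentSum F 3 (r + 1)) := by
  have h3 : Odd 3 := by decide
  rw [momentSum_four hF]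
  refine ⟨fun hr => ?_, fun hr => ?_⟩
  · rw [momentSum_eq_zero_of_odd hF h3 hr.add_one, sub_zero]
  · rw [momentSum_eq_zero_of_odd hF h3 hr, mul_zero, zero_sub]
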